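/- Let $R$ be a commutative ring and $q\in R$ (for instance $R=\mathbf{k}(q)$ with $\mathbf k$ a field and $q$ the indeterminate). For a composition $\alpha=(\alpha_1,\dots,\alpha_k)$ (of any size $n\ge 0$) let $$M_\alpha=\sum_{i_1<\cdots<i_k}x_{i_1}^{\alpha_1}\cdots x_{i_k}^{\alpha_k}$$ be the monomial quasisymmetric function, a formal power series over $R$ in the variables $x_1,x_2,x_3,\dots$, and let $\mathcal{Q}Sym$ be the $R$-module of quasisymmetric functions, i.e. the span of all $M_\alpha$ (which form a basis of it). Let $\mathrm{rev}:\mathcal{Q}Sym\to\mathcal{Q}Sym$ be the $R$-linear map with $\mathrm{rev}(M_\alpha)=M_{\mathrm{rev}(\alpha)}$, where $\mathrm{rev}(\alpha_1,\dots,\alpha_k)=(\alpha_k,\dots,\alpha_1)$. For a polyhedron $Q\subseteq\mathbb{R}^n$ and a nonempty face $G$ of $Q$, let $C_G$ be the normal cone of $Q$ at $G$, that is, the set of all $\omega\in\mathbb{R}^n$ such that $\langle\omega,\cdot\rangle$ is maximized over $Q$ at every point of $G$, and let $C_G^\circ$ be its relative interior. Put $$F_q(Q)=\sum_{G}\;q^{\dim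 G}\sum_{\omega\in\mathbb{Z}_{>0}^n\cap C_G^\circ}x_{\omega_1}x_{\omega_2}\cdots x_{\omega_n},$$ where $G$ runs over the nonempty faces of $Q$. Let $P$ be a poset on $[n]=\{1,\dots,n\}$. Its poset cone is $C(P)=\mathrm{cone}\{e_i-e_j : i<_P j\}\subseteq\mathbb{R}^n$, where $e_1,\dots,e_n$ is the standard basis, and its opposite poset $P^{op}$ is the poset on $[n]$ with $i<_{P^{op}}j$ if and only if $j<_P i$. **Proposition.** For every poset $P$ on $[n]$, the power series $F_q(C(P))$ belongs to $\mathcal{Q}Sym$, and $$F_q(C(P^{op}))=\mathrm{rev}\bigl(F_q(C(P))\bigr).$$ -/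

import Mathlib

/-! ### Quasisymmetric functions in the variables `x₁, x₂, x₃, …` -/

/-- The formal power series `∑ a, x ^ (m a)` attached to a family of exponents `m` that takes every
value finitely often: the coefficient of `x ^ d` is the number of `a` with `m a = d`. -/
noncomputable def monomialSum (R : Type*) [CommRing R] {ι : Type*} (m : ι → ℕ+ →₀ ℕ) :
    MvPowerSeries ℕ+ R :=
  fun d => (Nat.card {a : ι // m a = d} : R)

/-- The exponent of `x_{i₁} ^ α₁ ⋯ x_{iₖ} ^ αₖ`. -/
noncomputable def compositionExponent {n : ℕ} (α : Composition n) (i : Fin α.length → ℕ+) :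
    ℕ+ →₀ ℕ :=
  ∑ j, Finsupp.single (i j) (α.blocksFun j)

/-- The monomial quasisymmetric function
`M_α = ∑_{i₁ < ⋯ < iₖ} x_{i₁} ^ α₁ ⋯ x_{iₖ} ^ αₖ`. -/
noncomputable def monomialQSym (R : Type*) [CommRing R] {n : ℕ} (α : Composition n) :
    MvPowerSeries ℕ+ R :=
  monomialSum R fun i : {i : Fin α.length → ℕ+ // StrictMono i} => compositionExponent α i.1

/-- The monomial quasisymmetric functions of all compositions (of all sizes) as one family. -/
noncomputable def monomialQSymFamily (R : Type*) [CommRing R] :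
    (Σ n, Composition n) → MvPowerSeries ℕ+ R :=
  fun α => monomialQSym R α.2

/-- The module of quasisymmetric functions over `R`: the span of all `M_α`. -/
noncomputable def QSym (R : Type*) [CommRing R] : Submodule R (MvPowerSeries ℕ+ R) :=
  Submodule.span R (Set.range (monomialQSymFamily R))

theorem compositionExponent_apply {n : ℕ} (α : Composition n) {i : Fin α.length → ℕ+}
    (hi : StrictMono i) (j : Fin α.length) :
    compositionExponent α i (i j) = α.blocksFun j := by
  classical
  simp [compositionExponent, Finsupp.finsetSum_apply, Finsupp.single_apply, hi.injective.eq_iff]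

theorem support_compositionExponent {n : ℕ} (α : Composition n) {i : Fin α.length → ℕ+}
    (hi : StrictMono i) :
    (compositionExponent α i).support = Finset.univ.image i := by
  classical
  ext p
  simp only [Finset.mem_image, Finset.mem_univ, true_and]
  constructor
  · intro hp
    by_contra hne
    push Not at hne
    apply Finsupp.mem_support_iff.1 hp
    rw [compositionExponent, Finsupp.finsetSum_apply]
    exact Finset.sum_eq_zero fun j _ => Finsupp.single_eq_of_ne' (hne j)
  · rintro ⟨j, rfl⟩
    rw [Finsupp.mem_support_iff, compositionExponent_apply α hi]
    have := α.one_le_blocksFun j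
    omega

/-- The increasing sequence of indices and the composition can both be read off the exponent. -/
theorem sort_support_compositionExponent {n : ℕ} (α : Composition n) {i : Fin α.length → ℕ+}
    (hi : StrictMono i) :
    (compositionExponent α i).support.sort (· ≤ ·) = List.ofFn i := by
  classical
  rw [support_compositionExponent α hi]
  have h1 : (Finset.univ.image i) = (List.ofFn i).toFinset := by
    ext p; simp [List.mem_ofFn]
  rw [h1]
  exact (List.toFinset_sort (· ≤ ·) (List.nodup_ofFn.2 hi.injective)).2
    (List.pairwise_ofFn.2 fun _ _ h => (hi h).le)

theorem blocks_eq_of_compositionExponent {n : ℕ} (α : Composition n) {i : Fin α.length → ℕ+}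
    (hi : StrictMono i) :
    α.blocks = ((compositionExponent α i).support.sort (· ≤ ·)).map (compositionExponent α i) := by
  rw [sort_support_compositionExponent α hi, List.map_ofFn, ← α.ofFn_blocksFun]
  congr 1
  funext j
  exact (compositionExponent_apply α hi j).symm

theorem compositionExponent_injective {n : ℕ} (α : Composition n) :
    Function.Injective
      fun i : {i : Fin α.length → ℕ+ // StrictMono i} => compositionExponent α i.1 := by
  intro i j h
  have h' : compositionExponent α i.1 = compositionExponent α j.1 := h
  apply Subtype.ext
  apply List.ofFn_injective
  rw [← sort_support_compositionExponent α i.2, ← sort_support_compositionExponent α j.2, h']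

theorem monomialQSym_linearIndependent (R : Type*) [CommRing R] :
    LinearIndependent R (monomialQSymFamily R) := by
  classical
  let i₀ : (α : Σ n, Composition n) → Fin α.2.length → ℕ+ := fun _ j => j.1.succPNat
  have hi₀ : ∀ α, StrictMono (i₀ α) := fun α a b hab => Nat.succPNat_lt_succPNat.2 hab
  have key : ∀ α β : Σ n, Composition n,
      MvPowerSeries.coeff (compositionExponent β.2 (i₀ β)) (monomialQSymFamily R α)
        = if α = β then 1 else 0 := by
    intro α β
    change ((Nat.card {i : {i : Fin α.2.length → ℕ+ // StrictMono i} //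
      compositionExponent α.2 i.1 = compositionExponent β.2 (i₀ β)} : ℕ) : R) = _
    by_cases hαβ : α = β
    · subst hαβ
      have : Unique {i : {i : Fin α.2.length → ℕ+ // StrictMono i} //
          compositionExponent α.2 i.1 = compositionExponent α.2 (i₀ α)} :=
        { default := ⟨⟨i₀ α, hi₀ α⟩, rfl⟩
          uniq := fun a => Subtype.ext
            (compositionExponent_injective α.2 (a₂ := ⟨i₀ α, hi₀ α⟩) a.2) }
      simp
    · have : IsEmpty {i : {i : Fin α.2.length → ℕ+ // StrictMono i} //
          compositionExponent α.2 i.1 = compositionExponent β.2 (i₀ β)} := by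
        refine ⟨fun a => hαβ (Composition.sigma_eq_iff_blocks_eq.2 ?_)⟩
        rw [blocks_eq_of_compositionExponent α.2 a.1.2, a.2,
          ← blocks_eq_of_compositionExponent β.2 (hi₀ β)]
      simp [hαβ]
  rw [linearIndependent_iff]
  intro l hl
  ext β
  have h := congrArg (MvPowerSeries.coeff (compositionExponent β.2 (i₀ β))) hl
  rw [Finsupp.linearCombination_apply, Finsupp.sum, map_sum] at h
  simpa [key] using h

/-- The basis of `QSym` given by the `M_α`. -/
noncomputable def monomialBasis (R : Type*) [CommRing R] :
    Module.Basis (Σ n, Composition n) R (QSym R) :=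
  Module.Basis.span (monomialQSym_linearIndependent R)

/-- The linear map `rev : QSym → QSym` that sends `M_α` to `M_{rev α}`, where
`rev (α₁, …, αₖ) = (αₖ, …, α₁)`. -/
noncomputable def QSym.rev (R : Type*) [CommRing R] : QSym R →ₗ[R] QSym R :=
  (monomialBasis R).constr R fun α => monomialBasis R ⟨α.1, α.2.reverse⟩

theorem QSym.rev_monomialBasis (R : Type*) [CommRing R] {n : ℕ} (α : Composition n) :
    QSym.rev R (monomialBasis R ⟨n, α⟩) = monomialBasis R ⟨n, α.reverse⟩ :=
  (monomialBasis R).constr_basis R _ _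

theorem coe_monomialBasis (R : Type*) [CommRing R] {n : ℕ} (α : Composition n) :
    (monomialBasis R ⟨n, α⟩ : MvPowerSeries ℕ+ R) = monomialQSym R α :=
  Module.Basis.coe_span_apply (monomialQSym_linearIndependent R) ⟨n, α⟩

/-! ### The enumerator of integer points of a polyhedron -/

/-- The nonempty faces of `Q ⊆ ℝⁿ`: the nonempty sets of maximizers over `Q` of linear
functionals. -/
def faces {n : ℕ} (Q : Set (Fin n → ℝ)) : Set (Set (Fin n → ℝ)) :=
  {G | G.Nonempty ∧ IsExposed ℝ Q G}

/-- The normal cone of `Q` at `G`: the vectors `w` such that `⟨w, ·⟩` is maximized over `Q` at every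
point of `G`. -/
def normalCone {n : ℕ} (Q G : Set (Fin n → ℝ)) : Set (Fin n → ℝ) :=
  {w | ∀ x ∈ G, ∀ y ∈ Q, w ⬝ᵥ y ≤ w ⬝ᵥ x}

/-- The dimension of a (nonempty) face, i.e. of its affine span. -/
noncomputable def faceDim {n : ℕ} (G : Set (Fin n → ℝ)) : ℕ :=
  Module.finrank ℝ (vectorSpan ℝ G)

/-- The exponent of `x_{ω₁} ⋯ x_{ωₙ}`. -/
noncomputable def weightExponent {n : ℕ} (ω : Fin n → ℕ+) : ℕ+ →₀ ℕ :=
  ∑ i, Finsupp.single (ω i) 1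

theorem finite_weightExponent_eq {n : ℕ} (d : ℕ+ →₀ ℕ) :
    {ω : Fin n → ℕ+ | weightExponent ω = d}.Finite := by
  classical
  refine (Set.Finite.pi' (t := fun _ : Fin n => (d.support : Set ℕ+))
    fun _ => d.support.finite_toSet).subset ?_
  rintro ω rfl i
  simp only [Finset.mem_coe, Finsupp.mem_support_iff, weightExponent, Finsupp.finsetSum_apply]
  have h := Finset.single_le_sum (f := fun j => Finsupp.single (ω j) 1 (ω i))
    (fun _ _ => Nat.zero_le _) (Finset.mem_univ i)
  simp only [Finsupp.single_eq_same] at h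
  omega

/-- The positive integer vectors in the relative interior of the normal cone of `Q` at `G`. -/
def normalWeights {n : ℕ} (Q G : Set (Fin n → ℝ)) : Set (Fin n → ℕ+) :=
  {ω | (fun i => ((ω i : ℕ) : ℝ)) ∈ intrinsicInterior ℝ (normalCone Q G)}

/-- The enumerator `F_q(G) = q ^ dim G * ∑_ω x_{ω₁} ⋯ x_{ωₙ}` of a face `G` of `Q`, the sum being
over the positive integer vectors `ω` in the relative interior of the normal cone at `G`. -/
noncomputable def faceEnumerator {R : Type*} [CommRing R] (q : R) {n : ℕ}
    (Q G : Set (Fin n → ℝ)) : MvPowerSeries ℕ+ R :=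
  q ^ faceDim G • monomialSum R fun ω : normalWeights Q G => weightExponent ω.1

/-- The weighted enumerator `F_q(Q) = ∑_G F_q(G)` of a polyhedron `Q ⊆ ℝⁿ`, the sum being over its
finitely many nonempty faces. -/
noncomputable def enumerator {R : Type*} [CommRing R] (q : R) {n : ℕ}
    (Q : Set (Fin n → ℝ)) : MvPowerSeries ℕ+ R :=
  ∑ᶠ G ∈ faces Q, faceEnumerator q Q G

/-! ### Poset cones -/

/-- The poset cone `C(P) = cone {e_i - e_j : i <_P j}` of a partial order `P` on `n` elements. -/
noncomputable def posetCone {n : ℕ} (P : PartialOrder (Fin n)) : PointedCone ℝ (Fin n → ℝ) :=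
  PointedCone.hull ℝ
    {v | ∃ i j : Fin n, P.lt i j ∧ v = Pi.single i (1 : ℝ) - Pi.single j (1 : ℝ)}

/-- A poset cone has finitely many faces, so the sum that defines its enumerator is finite. -/
theorem finite_faces_posetCone {n : ℕ} (P : PartialOrder (Fin n)) :
    (faces (posetCone P : Set (Fin n → ℝ))).Finite := by
  classical
  set S : Set (Fin n → ℝ) :=
    {v | ∃ i j : Fin n, P.lt i j ∧ v = Pi.single i (1 : ℝ) - Pi.single j (1 : ℝ)} with hS
  have hSfin : S.Finite := by
    refine (Set.finite_range fun p : Fin n × Fin n =>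
      (Pi.single p.1 (1 : ℝ) - Pi.single p.2 (1 : ℝ) : Fin n → ℝ)).subset ?_
    rintro v ⟨i, j, -, rfl⟩
    exact ⟨(i, j), rfl⟩
  refine (hSfin.finite_subsets.image
    fun T => ((PointedCone.hull ℝ T : PointedCone ℝ (Fin n → ℝ)) : Set (Fin n → ℝ))).subset ?_
  rintro G ⟨hne, hG⟩
  obtain ⟨l, hl⟩ := hG hne
  obtain ⟨z, hz⟩ := hne
  have hz' : z ∈ posetCone P ∧ ∀ y ∈ posetCone P, l y ≤ l z := by
    rw [hl] at hz; exact hz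
  have hlz : l z = 0 := by
    have h0 := hz'.2 0 (posetCone P).zero_mem
    have h2 := hz'.2 (z + z) ((posetCone P).add_mem hz'.1 hz'.1)
    simp only [map_zero, map_add] at h0 h2
    linarith
  have hle : ∀ y ∈ posetCone P, l y ≤ 0 := fun y hy => hlz ▸ hz'.2 y hy
  have hmem : ∀ x, x ∈ G ↔ x ∈ posetCone P ∧ l x = 0 := by
    intro x
    rw [hl]
    constructor
    · rintro ⟨hx, hx'⟩
      exact ⟨hx, le_antisymm (hle x hx) (hlz ▸ hx' z hz'.1)⟩
    · rintro ⟨hx, hx'⟩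
      exact ⟨hx, fun y hy => hx'.symm ▸ hle y hy⟩
  refine ⟨S ∩ G, Set.inter_subset_left, ?_⟩
  apply Set.Subset.antisymm
  · intro x hx
    have hx' : x ∈ PointedCone.hull ℝ (S ∩ G) := hx
    induction hx' using Submodule.span_induction with
    | mem v hv => exact hv.2
    | zero => exact (hmem 0).2 ⟨(posetCone P).zero_mem, map_zero l⟩
    | add a b ha hb iha ihb =>
      have h1 := (hmem a).1 (iha ha)
      have h2 := (hmem b).1 (ihb hb)
      exact (hmem _).2 ⟨(posetCone P).add_mem h1.1 h2.1, by rw [map_add, h1.2, h2.2, add_zero]⟩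
    | smul c a ha iha =>
      have h1 := (hmem a).1 (iha ha)
      refine (hmem _).2 ⟨Submodule.smul_mem (posetCone P) c h1.1, ?_⟩
      change l ((c : ℝ) • a) = 0
      rw [map_smul, h1.2, smul_zero]
  · intro x hx
    obtain ⟨hxC, hx0⟩ := (hmem x).1 hx
    have hxC' : x ∈ PointedCone.hull ℝ S := hxC
    clear hx hxC
    change x ∈ PointedCone.hull ℝ (S ∩ G)
    induction hxC' using Submodule.span_induction with
    | mem v hv =>
      exact Submodule.subset_span ⟨hv, (hmem v).2 ⟨Submodule.subset_span hv, hx0⟩⟩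
    | zero => exact Submodule.zero_mem _
    | add a b ha hb iha ihb =>
      have h1 := hle a ha
      have h2 := hle b hb
      rw [map_add] at hx0
      exact Submodule.add_mem _ (iha (by linarith)) (ihb (by linarith))
    | smul c a ha iha =>
      have hc : (c : ℝ) * l a = 0 := by
        have h3 : l ((c : ℝ) • a) = 0 := hx0
        rwa [map_smul, smul_eq_mul] at h3
      rcases mul_eq_zero.1 hc with h | h
      · have : c = 0 := Subtype.ext h
        rw [this, zero_smul]
        exact Submodule.zero_mem _
      · exact Submodule.smul_mem _ _ (iha h)

/-- The opposite poset, on the same ground set. -/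
abbrev oppositePoset {α : Type*} (P : PartialOrder α) : PartialOrder α where
  le i j := P.le j i
  lt i j := P.lt j i
  le_refl i := P.le_refl i
  le_trans i j k hij hjk := P.le_trans k j i hjk hij
  lt_iff_le_not_ge i j := P.lt_iff_le_not_ge j i
  le_antisymm i j hij hji := P.le_antisymm i j hji hij

/-!
Let `C` be a cone with finite generating set `S`. A functional `⟨w, ·⟩` attains its maximum over `C`
exactly when it is nonpositive on `S`; the maximum is then `0`, and the maximizers form the face
`zeroFace S w`. Such a `w` lies in the relative interior of the normal cone at a single face, namely
this one (`mem_intrinsicInterior_normalCone_iff`). For the poset cone of `P`, nonpositivity on the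
generators `e_i - e_j` means that `w` is order-preserving on `P`, and the face of `w` has dimension
`tieDim P w`, the dimension of the span of the `e_i - e_j` with `i <_P j` and `w i = w j`. Hence the
coefficient of `x ^ d` in the enumerator is the sum of `q ^ tieDim P ω` over all order-preserving
`ω` that take each value `p` exactly `d p` times (`coeff_enumerator_posetCone`).

This sum, `orderPreservingSum`, makes sense with any linear order in place of the positive integers.
It does not change under a strictly increasing relabelling of the values, which gives the expansion
`enumerator_posetCone_eq_sum` of the enumerator in the `M_α`, with the coefficient of `M_α`
computed on the positions of the parts of `α`. Under a strictly decreasing relabelling,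
order-preserving maps on `P` become order-preserving maps on the opposite poset, while the dimension
is unaffected because the vectors `e_i - e_j` only change sign. So the coefficient of `M_α` for
`P` equals the coefficient of `M_{rev α}` for the opposite poset
(`orderPreservingSum_oppositePoset_reverse`).
-/

/-! ### Faces and normal cones of a finitely generated cone -/

section GeneratedCone

variable {n : ℕ} {S : Set (Fin n → ℝ)} {w : Fin n → ℝ}

/-- The part of the cone generated by `S` on which `⟨w, ·⟩` vanishes. If `w` is nonpositive on `S`,
this is the face of the maximizers of `⟨w, ·⟩`. -/
def zeroFace (S : Set (Fin n → ℝ)) (w : Fin n → ℝ) : Set (Fin n → ℝ) :=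
  {x | x ∈ PointedCone.hull ℝ S ∧ w ⬝ᵥ x = 0}

theorem zero_mem_zeroFace : (0 : Fin n → ℝ) ∈ zeroFace S w :=
  ⟨Submodule.zero_mem _, dotProduct_zero w⟩

theorem dotProduct_nonpos_of_mem_hull (hw : ∀ s ∈ S, w ⬝ᵥ s ≤ 0) {x : Fin n → ℝ}
    (hx : x ∈ PointedCone.hull ℝ S) : w ⬝ᵥ x ≤ 0 := by
  induction hx using Submodule.span_induction with
  | mem v hv => exact hw v hv
  | zero => simp
  | add a b _ _ iha ihb => rw [dotProduct_add]; linarith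
  | smul c a _ iha =>
    change w ⬝ᵥ ((c : ℝ) • a) ≤ 0
    rw [dotProduct_smul, smul_eq_mul]
    exact mul_nonpos_of_nonneg_of_nonpos c.2 iha

/-- A maximum of a linear functional over a cone is necessarily `0`. -/
theorem maximizers_eq_zeroFace (hw : ∀ s ∈ S, w ⬝ᵥ s ≤ 0) :
    {x | x ∈ PointedCone.hull ℝ S ∧ ∀ y ∈ PointedCone.hull ℝ S, w ⬝ᵥ y ≤ w ⬝ᵥ x} =
      zeroFace S w := by
  ext x
  refine ⟨fun ⟨hx, h⟩ => ⟨hx, le_antisymm (dotProduct_nonpos_of_mem_hull hw hx) ?_⟩,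
    fun ⟨hx, h⟩ => ⟨hx, fun y hy => h ▸ dotProduct_nonpos_of_mem_hull hw hy⟩⟩
  simpa using h 0 (Submodule.zero_mem _)

theorem dotProduct_nonpos_of_isMax {x : Fin n → ℝ} (hx : x ∈ PointedCone.hull ℝ S)
    (h : ∀ y ∈ PointedCone.hull ℝ S, w ⬝ᵥ y ≤ w ⬝ᵥ x) : ∀ s ∈ S, w ⬝ᵥ s ≤ 0 := by
  intro s hs
  have h1 := h (x + s) (Submodule.add_mem _ hx (Submodule.subset_span hs))
  rw [dotProduct_add] at h1
  linarith

theorem mem_faces_hull_iff {G : Set (Fin n → ℝ)} :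
    G ∈ faces (PointedCone.hull ℝ S : Set (Fin n → ℝ)) ↔
      ∃ w : Fin n → ℝ, (∀ s ∈ S, w ⬝ᵥ s ≤ 0) ∧ G = zeroFace S w := by
  constructor
  · rintro ⟨hne, hG⟩
    obtain ⟨l, rfl⟩ := hG hne
    obtain ⟨z, hz, hmax⟩ := hne
    obtain ⟨w, hl⟩ : ∃ w : Fin n → ℝ, ∀ y, l y = w ⬝ᵥ y := by
      refine ⟨fun i => l (Pi.single i 1), fun y => ?_⟩
      conv_lhs => rw [← Finset.univ_sum_single y, map_sum]
      refine Finset.sum_congr rfl fun i _ => ?_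
      rw [← mul_one (y i), ← smul_eq_mul, Pi.single_smul', map_smul, smul_eq_mul, smul_eq_mul,
        mul_one, mul_comm]
    simp only [hl] at hmax ⊢
    have hw := dotProduct_nonpos_of_isMax hz hmax
    exact ⟨_, hw, maximizers_eq_zeroFace hw⟩
  · rintro ⟨w, hw, rfl⟩
    refine ⟨⟨0, zero_mem_zeroFace⟩, fun _ => ?_⟩
    refine ⟨LinearMap.toContinuousLinearMap (dotProductBilin ℝ ℝ w), ?_⟩
    rw [← maximizers_eq_zeroFace hw]
    rfl

theorem mem_normalCone_zeroFace_iff {v : Fin n → ℝ} :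
    v ∈ normalCone (PointedCone.hull ℝ S : Set (Fin n → ℝ)) (zeroFace S w) ↔
      (∀ s ∈ S, v ⬝ᵥ s ≤ 0) ∧ ∀ x ∈ zeroFace S w, v ⬝ᵥ x = 0 := by
  constructor
  · intro h
    have hv := dotProduct_nonpos_of_isMax (Submodule.zero_mem _) (h 0 zero_mem_zeroFace)
    refine ⟨hv, fun x hx => le_antisymm (dotProduct_nonpos_of_mem_hull hv hx.1) ?_⟩
    simpa using h x hx 0 (Submodule.zero_mem _)
  · rintro ⟨hv, h0⟩ x hx y hy
    rw [h0 x hx]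
    exact dotProduct_nonpos_of_mem_hull hv hy

theorem zeroFace_subset_span (hw : ∀ s ∈ S, w ⬝ᵥ s ≤ 0) :
    zeroFace S w ⊆ Submodule.span ℝ {s | s ∈ S ∧ w ⬝ᵥ s = 0} := by
  rintro x ⟨hx, hx0⟩
  induction hx using Submodule.span_induction with
  | mem v hv => exact Submodule.subset_span ⟨hv, hx0⟩
  | zero => exact Submodule.zero_mem _
  | add a b ha hb iha ihb =>
    have h1 := dotProduct_nonpos_of_mem_hull hw ha
    have h2 := dotProduct_nonpos_of_mem_hull hw hb
    rw [dotProduct_add] at hx0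
    exact Submodule.add_mem _ (iha (by linarith)) (ihb (by linarith))
  | smul c a ha iha =>
    change w ⬝ᵥ ((c : ℝ) • a) = 0 at hx0
    rw [dotProduct_smul, smul_eq_mul] at hx0
    change (c : ℝ) • a ∈ Submodule.span ℝ {s | s ∈ S ∧ w ⬝ᵥ s = 0}
    rcases mul_eq_zero.1 hx0 with h | h
    · rw [h, zero_smul]
      exact Submodule.zero_mem _
    · exact Submodule.smul_mem _ _ (iha h)

theorem faceDim_zeroFace (hw : ∀ s ∈ S, w ⬝ᵥ s ≤ 0) :
    faceDim (zeroFace S w) =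
      Module.finrank ℝ (Submodule.span ℝ {s | s ∈ S ∧ w ⬝ᵥ s = 0}) := by
  have h : vectorSpan ℝ (zeroFace S w) = Submodule.span ℝ {s | s ∈ S ∧ w ⬝ᵥ s = 0} := by
    rw [vectorSpan_eq_span_vsub_set_right ℝ zero_mem_zeroFace]
    simp only [vsub_eq_sub, sub_zero, Set.image_id']
    exact le_antisymm (Submodule.span_le.2 (zeroFace_subset_span hw))
      (Submodule.span_mono fun s hs => ⟨Submodule.subset_span hs.1, hs.2⟩)
  rw [faceDim, h]

/-- The relative interiors of the normal cones partition the functionals that are bounded above on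
the cone: each of them lies in the one that belongs to its face of maximizers, and in no other. -/
theorem mem_intrinsicInterior_normalCone_iff (hS : S.Finite) {G : Set (Fin n → ℝ)}
    (hG : G ∈ faces (PointedCone.hull ℝ S : Set (Fin n → ℝ))) :
    w ∈ intrinsicInterior ℝ (normalCone (PointedCone.hull ℝ S : Set (Fin n → ℝ)) G) ↔
      (∀ s ∈ S, w ⬝ᵥ s ≤ 0) ∧ G = zeroFace S w := by
  obtain ⟨l, hl, rfl⟩ := mem_faces_hull_iff.1 hG
  set N := normalCone (PointedCone.hull ℝ S : Set (Fin n → ℝ)) (zeroFace S l) with hN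
  constructor
  · intro h
    obtain ⟨hw, hw0⟩ := mem_normalCone_zeroFace_iff.1 (intrinsicInterior_subset h)
    refine ⟨hw, Set.Subset.antisymm (fun x hx => ⟨hx.1, hw0 x hx⟩) fun x hx => ⟨hx.1, ?_⟩⟩
    refine le_antisymm (dotProduct_nonpos_of_mem_hull hl hx.1) ?_
    obtain ⟨y, hy, rfl⟩ := mem_intrinsicInterior.1 h
    have hlN : l ∈ N := mem_normalCone_zeroFace_iff.2 ⟨hl, fun x hx => hx.2⟩
    -- Moving from `w` a little away from `l` stays in the normal cone.
    let γ : ℝ → affineSpan ℝ N := fun t =>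
      ⟨AffineMap.lineMap (y : Fin n → ℝ) l t,
        AffineMap.lineMap_mem t y.2 (subset_affineSpan ℝ N hlN)⟩
    have hγ : Continuous γ := Continuous.subtype_mk AffineMap.lineMap_continuous _
    have h0 : γ 0 = y := Subtype.ext (AffineMap.lineMap_apply_zero _ _)
    have hev : ∀ᶠ t in nhds (0 : ℝ), γ t ∈ ((↑) ⁻¹' N : Set (affineSpan ℝ N)) :=
      hγ.continuousAt.eventually (by rw [h0]; exact mem_interior_iff_mem_nhds.1 hy)
    obtain ⟨t, ht, ht0⟩ :=
      ((hev.filter_mono nhdsWithin_le_nhds).and (self_mem_nhdsWithin (s := Set.Iio (0 : ℝ)))).exists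
    have hγt : ((γ t : affineSpan ℝ N) : Fin n → ℝ) = t • (l - (y : Fin n → ℝ)) + y := by
      simp [γ, AffineMap.lineMap_apply]
    have hmem : t • (l - (y : Fin n → ℝ)) + y ∈ N := hγt ▸ ht
    have h1 := dotProduct_nonpos_of_mem_hull (mem_normalCone_zeroFace_iff.1 hmem).1 hx.1
    rw [add_dotProduct, smul_dotProduct, sub_dotProduct, hx.2, smul_eq_mul] at h1
    have ht0' : t < 0 := ht0
    nlinarith
  · rintro ⟨hw, hGw⟩
    rw [hGw] at hN
    have hwN : w ∈ N := hN ▸ mem_normalCone_zeroFace_iff.2 ⟨hw, fun x hx => hx.2⟩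
    refine mem_intrinsicInterior.2 ⟨⟨w, subset_affineSpan ℝ N hwN⟩, ?_, rfl⟩
    rw [mem_interior_iff_mem_nhds]
    -- On the affine span of the normal cone the functionals vanish on the face, so only the strict
    -- inequalities at the generators outside the face remain; these are open conditions.
    have hvan : ∀ v ∈ affineSpan ℝ N, ∀ x ∈ zeroFace S w, v ⬝ᵥ x = 0 := by
      intro v hv x hx
      have hle : affineSpan ℝ N ≤ (LinearMap.ker (dotProductBilin ℝ ℝ x)).toAffineSubspace := by
        rw [affineSpan_le]
        intro u hu
        change x ⬝ᵥ u = 0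
        rw [dotProduct_comm]
        rw [hN] at hu
        exact (mem_normalCone_zeroFace_iff.1 hu).2 x hx
      rw [dotProduct_comm]
      exact hle hv
    have hopen : ∀ᶠ v : affineSpan ℝ N in nhds ⟨w, subset_affineSpan ℝ N hwN⟩,
        ∀ s ∈ S, w ⬝ᵥ s ≠ 0 → (v : Fin n → ℝ) ⬝ᵥ s < 0 := by
      rw [Filter.eventually_all_finite hS]
      intro s hs
      by_cases h0 : w ⬝ᵥ s = 0
      · simp [h0]
      · have hc : Continuous fun v : affineSpan ℝ N => (v : Fin n → ℝ) ⬝ᵥ s := by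
          exact continuous_finsetSum _ fun i _ =>
            ((continuous_apply i).comp continuous_subtype_val).mul_const _
        filter_upwards [hc.continuousAt.eventually_lt_const
          (show w ⬝ᵥ s < 0 from lt_of_le_of_ne (hw s hs) h0)] with v hv _ using hv
    filter_upwards [hopen] with v hv
    refine hN.symm.subset (mem_normalCone_zeroFace_iff.2 ⟨fun s hs => ?_, hvan v v.2⟩)
    by_cases h0 : w ⬝ᵥ s = 0
    · exact (hvan v v.2 s ⟨Submodule.subset_span hs, h0⟩).le
    · exact (hv s hs h0).le

end GeneratedCone

/-! ### Order-preserving maps and the coefficients of the enumerator -/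

section Coefficients

variable {n : ℕ}

/-- The dimension of the span of the vectors `e_i - e_j` with `i <_P j` and `f i = f j`. -/
noncomputable def tieDim {L : Type*} (P : PartialOrder (Fin n)) (f : Fin n → L) : ℕ :=
  Module.finrank ℝ (Submodule.span ℝ
    {v : Fin n → ℝ | ∃ i j, P.lt i j ∧ f i = f j ∧ v = Pi.single i (1 : ℝ) - Pi.single j (1 : ℝ)})

theorem tieDim_comp {L L' : Type*} (P : PartialOrder (Fin n)) (f : Fin n → L) {e : L → L'}
    (he : Function.Injective e) : tieDim P (e ∘ f) = tieDim P f := by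
  have h : {v : Fin n → ℝ | ∃ i j, P.lt i j ∧ (e ∘ f) i = (e ∘ f) j ∧
        v = Pi.single i (1 : ℝ) - Pi.single j (1 : ℝ)} =
      {v | ∃ i j, P.lt i j ∧ f i = f j ∧ v = Pi.single i (1 : ℝ) - Pi.single j (1 : ℝ)} := by
    simp only [Function.comp_apply, he.eq_iff]
  rw [tieDim, h, tieDim]

/-- Passing to the opposite poset replaces the generators by their negatives. -/
theorem tieDim_oppositePoset {L : Type*} (P : PartialOrder (Fin n)) (f : Fin n → L) :
    tieDim (oppositePoset P) f = tieDim P f := by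
  have h : {v : Fin n → ℝ | ∃ i j, (oppositePoset P).lt i j ∧ f i = f j ∧
        v = Pi.single i (1 : ℝ) - Pi.single j (1 : ℝ)} =
      -{v : Fin n → ℝ | ∃ i j, P.lt i j ∧ f i = f j ∧
        v = Pi.single i (1 : ℝ) - Pi.single j (1 : ℝ)} := by
    ext v
    constructor <;> rintro ⟨i, j, hij, hf, hv⟩
    · exact ⟨j, i, hij, hf.symm, by rw [hv, neg_sub]⟩
    · exact ⟨j, i, hij, hf.symm, by rw [← neg_neg v, hv, neg_sub]⟩
  rw [tieDim, h, Submodule.span_neg, tieDim]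

/-- The order-preserving maps from `P` to `L` that take each value `p` exactly `d p` times. -/
def orderPreservingMaps {L : Type*} [LinearOrder L] (P : PartialOrder (Fin n)) (d : L →₀ ℕ) :
    Set (Fin n → L) :=
  {f | (∀ i j, P.lt i j → f i ≤ f j) ∧ ∑ i, Finsupp.single (f i) 1 = d}

/-- The sum of `q ^ tieDim P f` over the order-preserving maps `f` from `P` to `L` with
multiplicities `d`. For `L = ℕ+` these are the coefficients of the enumerator of the poset cone. -/
noncomputable def orderPreservingSum {R : Type*} [CommRing R] (q : R) {L : Type*} [LinearOrder L]
    (P : PartialOrder (Fin n)) (d : L →₀ ℕ) : R :=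
  ∑ᶠ f ∈ orderPreservingMaps P d, q ^ tieDim P f

theorem mapDomain_sum_single {L L' : Type*} (f : Fin n → L) (e : L → L') :
    (∑ i, Finsupp.single (f i) 1 : L →₀ ℕ).mapDomain e = ∑ i, Finsupp.single ((e ∘ f) i) 1 := by
  rw [Finsupp.mapDomain_finsetSum]
  simp [Finsupp.mapDomain_single]

/-- A map whose multiplicities are those of a relabelled `d` is itself a relabelled map. -/
theorem exists_comp_eq_of_sum_single_eq_mapDomain {L L' : Type*} {e : L → L'}
    (he : Function.Injective e) {g : Fin n → L'} {d : L →₀ ℕ}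
    (hg : ∑ i, Finsupp.single (g i) 1 = d.mapDomain e) :
    ∃ f : Fin n → L, e ∘ f = g ∧ ∑ i, Finsupp.single (f i) 1 = d := by
  have hr : ∀ i, ∃ a, e a = g i := by
    intro i
    by_contra hi
    have h0 : d.mapDomain e (g i) = 0 := Finsupp.mapDomain_of_notMem_range d (g i) hi
    rw [← hg, Finsupp.finsetSum_apply, Finset.sum_eq_zero_iff] at h0
    simpa using h0 i (Finset.mem_univ i)
  choose f hf using hr
  obtain rfl : e ∘ f = g := funext hf
  exact ⟨f, rfl, Finsupp.mapDomain_injective he (by rw [mapDomain_sum_single, hg])⟩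

theorem orderPreservingSum_mapDomain_of_strictMono {R : Type*} [CommRing R] (q : R)
    {L L' : Type*} [LinearOrder L] [LinearOrder L'] (P : PartialOrder (Fin n)) {e : L → L'}
    (he : StrictMono e) (d : L →₀ ℕ) :
    orderPreservingSum q P (d.mapDomain e) = orderPreservingSum q P d := by
  refine (finsum_mem_eq_of_bijOn (e ∘ ·) ⟨?_, he.injective.comp_left.injOn, ?_⟩ ?_).symm
  · rintro f ⟨hf, rfl⟩
    exact ⟨fun i j hij => he.monotone (hf i j hij), (mapDomain_sum_single f e).symm⟩
  · rintro g ⟨hg, hd⟩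
    obtain ⟨f, rfl, hf⟩ := exists_comp_eq_of_sum_single_eq_mapDomain he.injective hd
    exact ⟨f, ⟨fun i j hij => he.le_iff_le.1 (hg i j hij), hf⟩, rfl⟩
  · intro f _
    rw [tieDim_comp P f he.injective]

theorem orderPreservingSum_mapDomain_of_strictAnti {R : Type*} [CommRing R] (q : R)
    {L L' : Type*} [LinearOrder L] [LinearOrder L'] (P : PartialOrder (Fin n)) {e : L → L'}
    (he : StrictAnti e) (d : L →₀ ℕ) :
    orderPreservingSum q (oppositePoset P) (d.mapDomain e) = orderPreservingSum q P d := by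
  refine (finsum_mem_eq_of_bijOn (e ∘ ·) ⟨?_, he.injective.comp_left.injOn, ?_⟩ ?_).symm
  · rintro f ⟨hf, rfl⟩
    exact ⟨fun i j hij => he.antitone (hf j i hij), (mapDomain_sum_single f e).symm⟩
  · rintro g ⟨hg, hd⟩
    obtain ⟨f, rfl, hf⟩ := exists_comp_eq_of_sum_single_eq_mapDomain he.injective hd
    exact ⟨f, ⟨fun i j hij => he.le_iff_ge.1 (hg j i hij), hf⟩, rfl⟩
  · intro f _
    rw [tieDim_oppositePoset, tieDim_comp P f he.injective]

/-- The generators of the poset cone. -/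
def posetConeGenerators (P : PartialOrder (Fin n)) : Set (Fin n → ℝ) :=
  {v | ∃ i j : Fin n, P.lt i j ∧ v = Pi.single i (1 : ℝ) - Pi.single j (1 : ℝ)}

theorem finite_posetConeGenerators (P : PartialOrder (Fin n)) : (posetConeGenerators P).Finite := by
  refine (Set.finite_range fun p : Fin n × Fin n =>
    (Pi.single p.1 (1 : ℝ) - Pi.single p.2 (1 : ℝ) : Fin n → ℝ)).subset ?_
  rintro v ⟨i, j, -, rfl⟩
  exact ⟨(i, j), rfl⟩

theorem dotProduct_generators_nonpos_iff (P : PartialOrder (Fin n)) (ω : Fin n → ℕ+) :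
    (∀ s ∈ posetConeGenerators P, (fun i => ((ω i : ℕ) : ℝ)) ⬝ᵥ s ≤ 0) ↔
      ∀ i j, P.lt i j → ω i ≤ ω j := by
  constructor
  · intro h i j hij
    have := h _ ⟨i, j, hij, rfl⟩
    rw [dotProduct_sub, dotProduct_single, dotProduct_single] at this
    simpa using this
  · rintro h s ⟨i, j, hij, rfl⟩
    rw [dotProduct_sub, dotProduct_single, dotProduct_single]
    simpa using h i j hij

theorem faceDim_zeroFace_posetConeGenerators (P : PartialOrder (Fin n)) {ω : Fin n → ℕ+}
    (hω : ∀ i j, P.lt i j → ω i ≤ ω j) :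
    faceDim (zeroFace (posetConeGenerators P) fun i => ((ω i : ℕ) : ℝ)) = tieDim P ω := by
  have h : {s | s ∈ posetConeGenerators P ∧ (fun i => ((ω i : ℕ) : ℝ)) ⬝ᵥ s = 0} =
      {v | ∃ i j, P.lt i j ∧ ω i = ω j ∧ v = Pi.single i (1 : ℝ) - Pi.single j (1 : ℝ)} := by
    ext v
    constructor
    · rintro ⟨⟨i, j, hij, rfl⟩, h⟩
      refine ⟨i, j, hij, ?_, rfl⟩
      rw [dotProduct_sub, dotProduct_single, dotProduct_single] at h
      simpa [sub_eq_zero] using h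
    · rintro ⟨i, j, hij, h, rfl⟩
      refine ⟨⟨i, j, hij, rfl⟩, ?_⟩
      rw [dotProduct_sub, dotProduct_single, dotProduct_single]
      simp [h]
  rw [faceDim_zeroFace ((dotProduct_generators_nonpos_iff P ω).2 hω), h, tieDim]

theorem coeff_faceEnumerator {R : Type*} [CommRing R] (q : R) (Q G : Set (Fin n → ℝ))
    (d : ℕ+ →₀ ℕ) [DecidablePred (· ∈ normalWeights Q G)] :
    MvPowerSeries.coeff d (faceEnumerator q Q G) =
      ∑ ω ∈ (finite_weightExponent_eq (n := n) d).toFinset,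
        if ω ∈ normalWeights Q G then q ^ faceDim G else 0 := by
  have hcard : Nat.card {a : normalWeights Q G // weightExponent a.1 = d} =
      ((finite_weightExponent_eq (n := n) d).toFinset.filter (· ∈ normalWeights Q G)).card := by
    rw [← Nat.card_eq_finsetCard]
    refine Nat.card_congr ((Equiv.subtypeSubtypeEquivSubtypeInter _
      (fun ω => weightExponent ω = d)).trans (Equiv.subtypeEquivRight fun ω => ?_))
    simp [and_comm]
  rw [← Finset.sum_filter, Finset.sum_const, ← hcard, faceEnumerator, map_smul, smul_eq_mul,
    nsmul_eq_mul, mul_comm]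
  rfl

theorem coeff_enumerator_posetCone {R : Type*} [CommRing R] (q : R) (P : PartialOrder (Fin n))
    (d : ℕ+ →₀ ℕ) :
    MvPowerSeries.coeff d (enumerator q (posetCone P : Set (Fin n → ℝ))) =
      orderPreservingSum q P d := by
  classical
  have hset : orderPreservingMaps P d = ((finite_weightExponent_eq d).toFinset.filter
      fun ω : Fin n → ℕ+ => ∀ i j, P.lt i j → ω i ≤ ω j) := by
    ext ω
    simp [orderPreservingMaps, weightExponent, and_comm]
  rw [enumerator, finsum_mem_eq_finite_toFinset_sum _ (finite_faces_posetCone P), map_sum,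
    Finset.sum_congr rfl fun G _ => coeff_faceEnumerator q _ G d, Finset.sum_comm,
    orderPreservingSum, hset, finsum_mem_coe_finset, Finset.sum_filter]
  refine Finset.sum_congr rfl fun ω _ => ?_
  have key : ∀ G ∈ faces (posetCone P : Set (Fin n → ℝ)),
      (ω ∈ normalWeights (posetCone P : Set (Fin n → ℝ)) G ↔ (∀ i j, P.lt i j → ω i ≤ ω j) ∧
        G = zeroFace (posetConeGenerators P) fun i => ((ω i : ℕ) : ℝ)) := fun G hG => by
    rw [← dotProduct_generators_nonpos_iff]
    exact mem_intrinsicInterior_normalCone_iff (finite_posetConeGenerators P) hG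
  split_ifs with h
  · have hmem : zeroFace (posetConeGenerators P) (fun i => ((ω i : ℕ) : ℝ)) ∈
        faces (posetCone P : Set (Fin n → ℝ)) :=
      mem_faces_hull_iff.2 ⟨_, (dotProduct_generators_nonpos_iff P ω).2 h, rfl⟩
    rw [Finset.sum_eq_single_of_mem _ ((Set.Finite.mem_toFinset _).2 hmem),
      if_pos ((key _ hmem).2 ⟨h, rfl⟩), faceDim_zeroFace_posetConeGenerators P h]
    intro G hG hne
    exact if_neg fun hω => hne ((key G ((Set.Finite.mem_toFinset _).1 hG)).1 hω).2
  · exact Finset.sum_eq_zero fun G hG =>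
      if_neg fun hω => h ((key G ((Set.Finite.mem_toFinset _).1 hG)).1 hω).1

end Coefficients

/-! ### Expansion in monomial quasisymmetric functions -/

section Expansion

variable {n : ℕ}

/-- The parts of a composition as a finitely supported function on their positions. -/
noncomputable def blocksFinsupp (α : Composition n) : Fin α.length →₀ ℕ :=
  Finsupp.equivFunOnFinite.symm α.blocksFun

theorem mapDomain_blocksFinsupp (α : Composition n) (i : Fin α.length → ℕ+) :
    (blocksFinsupp α).mapDomain i = compositionExponent α i := by
  rw [Finsupp.mapDomain, Finsupp.sum_fintype _ _ (by simp)]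
  rfl

theorem coeff_monomialQSym (R : Type*) [CommRing R] (α β : Composition n)
    {i : Fin β.length → ℕ+} (hi : StrictMono i) [Decidable (α = β)] :
    MvPowerSeries.coeff (compositionExponent β i) (monomialQSym R α) =
      if α = β then 1 else 0 := by
  change ((Nat.card {j : {j : Fin α.length → ℕ+ // StrictMono j} //
    compositionExponent α j.1 = compositionExponent β i} : ℕ) : R) = _
  by_cases hαβ : α = β
  · subst hαβ
    have : Unique {j : {j : Fin α.length → ℕ+ // StrictMono j} //
        compositionExponent α j.1 = compositionExponent α i} :=
      { default := ⟨⟨i, hi⟩, rfl⟩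
        uniq := fun a => Subtype.ext (compositionExponent_injective α (a₂ := ⟨i, hi⟩) a.2) }
    simp
  · have : IsEmpty {j : {j : Fin α.length → ℕ+ // StrictMono j} //
        compositionExponent α j.1 = compositionExponent β i} := by
      refine ⟨fun a => hαβ (Composition.ext ?_)⟩
      rw [blocks_eq_of_compositionExponent α a.1.2, a.2,
        ← blocks_eq_of_compositionExponent β hi]
    simp [hαβ]

theorem degree_compositionExponent (α : Composition n) (i : Fin α.length → ℕ+) :
    (compositionExponent α i).degree = n := by
  simp [compositionExponent, map_sum, α.sum_blocksFun]

theorem coeff_monomialQSym_of_degree_ne (R : Type*) [CommRing R] (α : Composition n)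
    {d : ℕ+ →₀ ℕ} (hd : d.degree ≠ n) : MvPowerSeries.coeff d (monomialQSym R α) = 0 := by
  change ((Nat.card {j : {j : Fin α.length → ℕ+ // StrictMono j} //
    compositionExponent α j.1 = d} : ℕ) : R) = 0
  have : IsEmpty {j : {j : Fin α.length → ℕ+ // StrictMono j} //
      compositionExponent α j.1 = d} :=
    ⟨fun a => hd (a.2 ▸ degree_compositionExponent α a.1.1)⟩
  simp

theorem orderPreservingSum_of_degree_ne {R : Type*} [CommRing R] (q : R)
    (P : PartialOrder (Fin n)) {d : ℕ+ →₀ ℕ} (hd : d.degree ≠ n) :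
    orderPreservingSum q P d = 0 := by
  have : orderPreservingMaps P d = ∅ := by
    refine Set.eq_empty_of_forall_notMem ?_
    rintro f ⟨-, rfl⟩
    simp [map_sum] at hd
  rw [orderPreservingSum, this, finsum_mem_empty]

/-- Every exponent of degree `n` is obtained by listing its nonzero entries in the order of the
variables. -/
theorem exists_eq_compositionExponent (d : ℕ+ →₀ ℕ) (hd : d.degree = n) :
    ∃ (α : Composition n) (i : Fin α.length → ℕ+), StrictMono i ∧ compositionExponent α i = d := by
  have hlen : (List.ofFn fun j => d (d.support.orderEmbOfFin rfl j)).length = d.support.card := by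
    simp
  have hsum : ∑ j, Finsupp.single (d.support.orderEmbOfFin rfl j)
      (d (d.support.orderEmbOfFin rfl j)) = d := by
    conv_rhs => rw [← d.sum_single, Finsupp.sum, ← Finset.image_orderEmbOfFin_univ d.support rfl]
    rw [Finset.sum_image fun a _ b _ h => (d.support.orderEmbOfFin rfl).injective h]
  let α : Composition n :=
    { blocks := List.ofFn fun j => d (d.support.orderEmbOfFin rfl j)
      blocks_pos := by
        intro b hb
        obtain ⟨j, rfl⟩ := List.mem_ofFn.1 hb
        exact Nat.pos_of_ne_zero (Finsupp.mem_support_iff.1 (d.support.orderEmbOfFin_mem rfl j))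
      blocks_sum := by
        rw [List.sum_ofFn, ← hd]
        conv_rhs => rw [← hsum, map_sum]
        simp }
  refine ⟨α, fun j => d.support.orderEmbOfFin rfl (Fin.cast hlen j), ?_, ?_⟩
  · intro a b hab
    exact (d.support.orderEmbOfFin rfl).strictMono hab
  · refine (Fintype.sum_equiv (finCongr hlen) _ _ fun j => ?_).trans hsum
    congr 1
    simp only [α, Composition.blocksFun, List.get_ofFn]
    rfl

theorem enumerator_posetCone_eq_sum {R : Type*} [CommRing R] (q : R) (P : PartialOrder (Fin n)) :
    enumerator q (posetCone P : Set (Fin n → ℝ)) =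
      ∑ α : Composition n, orderPreservingSum q P (blocksFinsupp α) • monomialQSym R α := by
  ext d
  rw [coeff_enumerator_posetCone, map_sum]
  by_cases hd : d.degree = n
  · obtain ⟨β, i, hi, rfl⟩ := exists_eq_compositionExponent d hd
    simp only [map_smul, coeff_monomialQSym R _ β hi, smul_eq_mul, mul_ite, mul_one, mul_zero]
    rw [Finset.sum_ite_eq' Finset.univ β, if_pos (Finset.mem_univ β), ← mapDomain_blocksFinsupp,
      orderPreservingSum_mapDomain_of_strictMono q P hi]
  · rw [orderPreservingSum_of_degree_ne q P hd]
    refine (Finset.sum_eq_zero fun α _ => ?_).symm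
    rw [map_smul, coeff_monomialQSym_of_degree_ne R α hd, smul_zero]

/-- The positions of the parts of `α`, read from right to left as positions of `α.reverse`. -/
def reversePosition (α : Composition n) (j : Fin α.length) : Fin α.reverse.length :=
  Fin.cast (by simp [Composition.length]) j.rev

theorem strictAnti_reversePosition (α : Composition n) : StrictAnti (reversePosition α) :=
  fun _ _ h => Fin.rev_lt_rev.2 h

theorem mapDomain_reversePosition (α : Composition n) :
    (blocksFinsupp α).mapDomain (reversePosition α) = blocksFinsupp α.reverse := by
  ext k
  obtain ⟨j, rfl⟩ : ∃ j, reversePosition α j = k :=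
    ⟨(Fin.cast (by simp [Composition.length]) k).rev, by simp [reversePosition]⟩
  rw [Finsupp.mapDomain_apply (strictAnti_reversePosition α).injective]
  have hj : α.blocks.length - 1 - (α.blocks.length - (j.1 + 1)) = j.1 := by
    have : j.1 < α.blocks.length := j.2
    omega
  simp [blocksFinsupp, Composition.blocksFun, reversePosition, Composition.length, hj]

theorem orderPreservingSum_oppositePoset_reverse {R : Type*} [CommRing R] (q : R)
    (P : PartialOrder (Fin n)) (α : Composition n) :
    orderPreservingSum q (oppositePoset P) (blocksFinsupp α.reverse) =
      orderPreservingSum q P (blocksFinsupp α) := by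
  rw [← mapDomain_reversePosition,
    orderPreservingSum_mapDomain_of_strictAnti q P (strictAnti_reversePosition α)]

end Expansion

theorem mainTheorem6 {R : Type*} [CommRing R] (q : R) {n : ℕ} (P : PartialOrder (Fin n)) :
    ∃ h : enumerator q (posetCone P : Set (Fin n → ℝ)) ∈ QSym R,
      enumerator q (posetCone (oppositePoset P) : Set (Fin n → ℝ)) =
        (QSym.rev R ⟨enumerator q (posetCone P : Set (Fin n → ℝ)), h⟩ : MvPowerSeries ℕ+ R) := by
  have hP : enumerator q (posetCone P : Set (Fin n → ℝ)) =
      ((∑ α : Composition n, orderPreservingSum q P (blocksFinsupp α) • monomialBasis R ⟨n, α⟩ :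
        QSym R) : MvPowerSeries ℕ+ R) := by
    simp [enumerator_posetCone_eq_sum, coe_monomialBasis]
  refine ⟨hP ▸ Subtype.property _, ?_⟩
  simp only [hP, Subtype.coe_eta, map_sum, map_smul, QSym.rev_monomialBasis]
  rw [enumerator_posetCone_eq_sum,
    ← Equiv.sum_comp (Function.Involutive.toPerm _ Composition.reverse_involutive)]
  rw [AddSubmonoidClass.coe_finsetSum]
  refine Finset.sum_congr rfl fun α _ => ?_
  rw [Function.Involutive.coe_toPerm, orderPreservingSum_oppositePoset_reverse,
    Submodule.coe_smul, coe_monomialBasis]
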